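/- \textbf{Conventions.} A \emph{forest algebra} is a pair $\mathcal F=(H,V)$ of monoids, $(H,+,0)$ and $(V,\cdot,1)$, with a faithful monoid action of $V$ on $H$, such that for every $h\in H$ there is $I_h\in V$ with $I_h h'=h+h'$ for all $h'\in H$, and such that every $h\in H$ is of the form $v\cdot 0$ with $v\in V$. All forest algebras are assumed to be horizontally commutative and idempotent: $h+h'=h'+h$ and $h+h=h$. They may be finite or infinite. A \emph{morphism} $(H,V)\to(H',V')$ is a pair of monoid morphisms $H\to H'$, $V\to V'$ compatible with the actions and with $h\mapsto I_h$. A \emph{subalgebra} of $(H,V)$ is a pair of submonoids of $H$ and $V$ closed under the action and under $h\mapsto I_h$ (its action on itself need not be faithful). $\mathcal F$ \emph{divides} $\mathcal G$ if $\mathcal F$ is a quotient of a subalgebra of $\mathcal G$, that is, the image of that subalgebra under a pair of surjective monoid morphisms compatible with the action and with $h\mapsto I_h$. The \emph{wreath product} of $(H_1,V_1)$ and $(H_2,V_2)$ is $(H_1,V_1)\wr(H_2,V_2)=(H_1\times H_2,\;V_1^{H_2}\times V_2)$, where $H_1\times H_2$ is the direct product, $(f,v)(h_1,h_2)=(f(h_2)h_1,\,vh_2)$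 and $(f,v)(f',v')=(f'',vv')$ with $f''(h)=f(v'h)\,f'(h)$. A forest algebra $(H,V)$ is \emph{distributive} if $v(h_1+h_2)=vh_1+vh_2$ for all $v\in V$, $h_1,h_2\in H$. For an alphabet $\Sigma$ (a finite set), let $\Sigma^\Delta=(H_\Sigma,V_\Sigma)$ be the free forest algebra: $H_\Sigma$ is the set of finite forests with nodes labelled in $\Sigma$, considered without regard to order and multiplicity of siblings, with union as addition; $V_\Sigma$ is the monoid of contexts (forests in which exactly one leaf is labelled by a variable instead of a letter), multiplied by substitution for the variable and acting on $H_\Sigma$ by insertion. For $f\in H_\Sigma$ let $\pi(f)\subseteq\Sigma^*$ be the set of label words of the (not necessarily maximal, possibly empty) paths in $f$ that start at a root. A forest algebra $\mathcal F$ is \emph{2-distributive} if for every alphabet $\Sigma$, every morphism $\phi:\Sigma^\Delta\to\mathcal F$, every $v\in V_\Sigma$ and all $f_1,f_2\in H_\Sigma$ with $\pi(f_1)=\pi(f_2)$ one has $\phi(v(f_1+f_2))=\phi(vf_1+vf_2)$. \textbf{Theorem.} A forest algebra $\mathcal F$, finite or infinite, is 2-distributive if and only if there are distributive forest algebras $\mathcal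 F_1,\mathcal F_2$, possibly infinite, such that $\mathcal F$ divides $\mathcal F_1\wr\mathcal F_2$. -/

import Mathlib

universe u v

/-- A forest algebra `(H, V)`, horizontally commutative and idempotent. -/
structure ForestAlgebra : Type (u + 1) where
  /-- forest types -/
  H : Type u
  /-- context types -/
  V : Type u
  [addCommMonoidH : AddCommMonoid H]
  [monoidV : Monoid V]
  [mulActionVH : MulAction V H]
  faithful : ∀ v w : V, (∀ h : H, v • h = w • h) → v = w
  /-- the insertion map `h ↦ I_h` -/
  ins : H → V
  ins_smul : ∀ h h' : H, ins h • h' = h + h'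
  exists_smul_zero : ∀ h : H, ∃ v : V, h = v • (0 : H)
  add_self : ∀ h : H, h + h = h

attribute [instance] ForestAlgebra.addCommMonoidH ForestAlgebra.monoidV ForestAlgebra.mulActionVH

namespace ForestAlgebra

/-- Morphisms of forest algebras. -/
structure Hom (F : ForestAlgebra.{u}) (G : ForestAlgebra.{v}) where
  onH : F.H →+ G.H
  onV : F.V →* G.V
  map_smul : ∀ (x : F.V) (h : F.H), onH (x • h) = onV x • onH h
  map_ins : ∀ h : F.H, onV (F.ins h) = G.ins (onH h)

/-- Subalgebras: pairs of subsets closed under all forest algebra operations. (The action of the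
contexts of a subalgebra on its own forests is not required to be faithful.) -/
structure Subalgebra (G : ForestAlgebra.{u}) where
  setH : AddSubmonoid G.H
  setV : Submonoid G.V
  smul_mem : ∀ x ∈ setV, ∀ h ∈ setH, x • h ∈ setH
  ins_mem : ∀ h ∈ setH, G.ins h ∈ setV

/-- `F` divides `G`: `F` is a quotient, that is, the image under a pair of surjective maps that
respect all forest algebra operations, of a subalgebra of `G`. -/
def Divides (F : ForestAlgebra.{u}) (G : ForestAlgebra.{v}) : Prop :=
  ∃ (S : Subalgebra G) (α : S.setH →+ F.H) (β : S.setV →* F.V),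
    Function.Surjective α ∧ Function.Surjective β ∧
    (∀ (x : S.setV) (h : S.setH),
      α ⟨(x : G.V) • (h : G.H), S.smul_mem x x.2 h h.2⟩ = β x • α h) ∧
    (∀ h : S.setH, β ⟨G.ins h, S.ins_mem h h.2⟩ = F.ins (α h))

/-- Distributivity: `v (h₁ + h₂) = v h₁ + v h₂`. -/
def Distributive (F : ForestAlgebra.{u}) : Prop :=
  ∀ (x : F.V) (h₁ h₂ : F.H), x • (h₁ + h₂) = x • h₁ + x • h₂

/-! ### The wreath product -/

/-- The contexts `V₁^{H₂} × V₂` of the wreath product. -/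
@[ext] structure WreathV (F₁ : ForestAlgebra.{u}) (F₂ : ForestAlgebra.{v}) : Type (max u v) where
  fn : F₂.H → F₁.V
  ctx : F₂.V

instance (F₁ : ForestAlgebra.{u}) (F₂ : ForestAlgebra.{v}) : Monoid (WreathV F₁ F₂) where
  mul p q := ⟨fun h => p.fn (q.ctx • h) * q.fn h, p.ctx * q.ctx⟩
  one := ⟨fun _ => 1, 1⟩
  mul_assoc p q r := by
    refine WreathV.ext (funext fun h => ?_) (mul_assoc p.ctx q.ctx r.ctx)
    change (p.fn (q.ctx • r.ctx • h) * q.fn (r.ctx • h)) * r.fn h =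
      p.fn ((q.ctx * r.ctx) • h) * (q.fn (r.ctx • h) * r.fn h)
    rw [mul_smul, mul_assoc]
  one_mul p := WreathV.ext (funext fun h => one_mul (p.fn h)) (one_mul p.ctx)
  mul_one p := by
    refine WreathV.ext (funext fun h => ?_) (mul_one p.ctx)
    change p.fn ((1 : F₂.V) • h) * 1 = p.fn h
    rw [one_smul, mul_one]

instance (F₁ : ForestAlgebra.{u}) (F₂ : ForestAlgebra.{v}) :
    MulAction (WreathV F₁ F₂) (F₁.H × F₂.H) where
  smul p h := (p.fn h.2 • h.1, p.ctx • h.2)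
  one_smul h := Prod.ext (one_smul F₁.V h.1) (one_smul F₂.V h.2)
  mul_smul p q h := Prod.ext (mul_smul (p.fn (q.ctx • h.2)) (q.fn h.2) h.1)
    (mul_smul p.ctx q.ctx h.2)

/-- The wreath product `F₁ ≀ F₂ = (H₁ × H₂, V₁^{H₂} × V₂)`. -/
def wreath (F₁ : ForestAlgebra.{u}) (F₂ : ForestAlgebra.{v}) : ForestAlgebra.{max u v} where
  H := F₁.H × F₂.H
  V := WreathV F₁ F₂
  faithful p q hpq := by
    refine WreathV.ext (funext fun h₂ => ?_) ?_
    · exact F₁.faithful _ _ fun h₁ => congrArg Prod.fst (hpq (h₁, h₂))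
    · exact F₂.faithful _ _ fun h₂ => congrArg Prod.snd (hpq (0, h₂))
  ins h := ⟨fun _ => F₁.ins h.1, F₂.ins h.2⟩
  ins_smul h h' := Prod.ext (F₁.ins_smul h.1 h'.1) (F₂.ins_smul h.2 h'.2)
  exists_smul_zero h := by
    refine ⟨⟨fun _ => F₁.ins h.1, F₂.ins h.2⟩, Prod.ext ?_ ?_⟩
    · exact ((F₁.ins_smul h.1 0).trans (add_zero h.1)).symm
    · exact ((F₂.ins_smul h.2 0).trans (add_zero h.2)).symm
  add_self h := Prod.ext (F₁.add_self h.1) (F₂.add_self h.2)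

end ForestAlgebra

/-! ### Forests, contexts and the free forest algebra -/

/-- Finite ordered forests with nodes labelled in `A`: either empty, or a first tree
`a[children]` followed by the forest `siblings` of its right siblings. -/
inductive OrderedForest (A : Type u) : Type u
  | nil : OrderedForest A
  | cons (a : A) (children siblings : OrderedForest A) : OrderedForest A

namespace OrderedForest

variable {A : Type u}

/-- Equality of ordered forests up to order and multiplicity of siblings (at every node). -/
inductive Rel : OrderedForest A → OrderedForest A → Prop
  | refl (f : OrderedForest A) : Rel f f
  | symm {f g : OrderedForest A} : Rel f g → Rel g f
  | trans {f g h : OrderedForest A} : Rel f g → Rel g h → Rel f h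
  | cons (a : A) {f f' s s' : OrderedForest A} :
      Rel f f' → Rel s s' → Rel (.cons a f s) (.cons a f' s')
  | swap (a b : A) (f g s : OrderedForest A) :
      Rel (.cons a f (.cons b g s)) (.cons b g (.cons a f s))
  | dup (a : A) (f s : OrderedForest A) : Rel (.cons a f (.cons a f s)) (.cons a f s)

instance setoid (A : Type u) : Setoid (OrderedForest A) := ⟨Rel, Rel.refl, Rel.symm, Rel.trans⟩

/-- Juxtaposition of ordered forests. -/
def append : OrderedForest A → OrderedForest A → OrderedForest A
  | nil, g => g
  | cons a f s, g => cons a f (append s g)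

/-- The set of (not necessarily maximal) paths of a forest starting at a root, as words over `A`;
the empty path is included. -/
def paths : OrderedForest A → Set (List A)
  | nil => {[]}
  | cons a f s => (List.cons a '' paths f) ∪ paths s

/-- Height of a forest. -/
def height : OrderedForest A → ℕ
  | nil => 0
  | cons _ f s => max (height f + 1) (height s)

/-- `HasTree b x f`: up to order and multiplicity, `b[x]` is one of the trees of `f`. -/
def HasTree (b : A) (x : OrderedForest A) : OrderedForest A → Prop
  | nil => False
  | cons a f s => (b = a ∧ Rel x f) ∨ HasTree b x s

theorem append_nil (f : OrderedForest A) : append f nil = f := by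
  induction f with
  | nil => rfl
  | cons a f s _ ih => simp [append, ih]

theorem append_assoc (f g h : OrderedForest A) :
    append (append f g) h = append f (append g h) := by
  induction f with
  | nil => rfl
  | cons a f s _ ih => simp [append, ih]

theorem append_rel_right (f : OrderedForest A) {g g' : OrderedForest A} (h : Rel g g') :
    Rel (append f g) (append f g') := by
  induction f with
  | nil => exact h
  | cons a f s _ ih => exact .cons a (.refl f) ih

theorem append_rel_left {f f' : OrderedForest A} (h : Rel f f') (g : OrderedForest A) :
    Rel (append f g) (append f' g) := by
  induction h with
  | refl f => exact .refl _
  | symm _ ih => exact .symm ih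
  | trans _ _ ih₁ ih₂ => exact .trans ih₁ ih₂
  | cons a hf _ _ ih => exact .cons a hf ih
  | swap a b f g' s => exact .swap a b f g' _
  | dup a f s => exact .dup a f _

theorem append_cons_rel (a : A) (f s g : OrderedForest A) :
    Rel (append g (cons a f s)) (cons a f (append g s)) := by
  induction g with
  | nil => exact .refl _
  | cons b x y _ ih => exact .trans (.cons b (.refl x) ih) (.swap _ _ _ _ _)

theorem append_comm_rel (f g : OrderedForest A) : Rel (append f g) (append g f) := by
  induction f with
  | nil => rw [append_nil]; exact .refl _
  | cons a f s _ ih => exact .trans (.cons a (.refl f) ih) (.symm (append_cons_rel a f s g))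

theorem append_self_rel (f : OrderedForest A) : Rel (append f f) f := by
  induction f with
  | nil => exact .refl _
  | cons a f s _ ih =>
    exact .trans (.cons a (.refl f) (append_cons_rel a f s s))
      (.trans (.dup a f _) (.cons a (.refl f) ih))

theorem paths_rel {f g : OrderedForest A} (h : Rel f g) : paths f = paths g := by
  induction h with
  | refl f => rfl
  | symm _ ih => exact ih.symm
  | trans _ _ ih₁ ih₂ => exact ih₁.trans ih₂
  | cons a _ _ ih₁ ih₂ => simp [paths, ih₁, ih₂]
  | swap a b f g s => exact Set.union_left_comm _ _ _
  | dup a f s => simp [paths]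

theorem height_rel {f g : OrderedForest A} (h : Rel f g) : height f = height g := by
  induction h with
  | refl f => rfl
  | symm _ ih => exact ih.symm
  | trans _ _ ih₁ ih₂ => exact ih₁.trans ih₂
  | cons a _ _ ih₁ ih₂ => simp [height, ih₁, ih₂]
  | swap a b f g s => exact max_left_comm _ _ _
  | dup a f s => simp [height]

theorem hasTree_rel (b : A) (x : OrderedForest A) {f g : OrderedForest A} (h : Rel f g) :
    HasTree b x f ↔ HasTree b x g := by
  induction h with
  | refl f => rfl
  | symm _ ih => exact ih.symm
  | trans _ _ ih₁ ih₂ => exact ih₁.trans ih₂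
  | cons a h₁ _ _ ih₂ =>
    have e : ∀ {y z : OrderedForest A}, Rel y z → (Rel x y ↔ Rel x z) :=
      fun h => ⟨fun k => k.trans h, fun k => k.trans h.symm⟩
    simp only [HasTree, ih₂, e h₁]
  | swap a b f g s => exact or_left_comm
  | dup a f s => simp [HasTree]

theorem hasTree_append (b : A) (x f g : OrderedForest A) :
    HasTree b x (append f g) ↔ HasTree b x f ∨ HasTree b x g := by
  induction f with
  | nil => simp [append, HasTree]
  | cons a f s _ ih => simp [append, HasTree, ih, or_assoc]

theorem height_append (f g : OrderedForest A) :
    height (append f g) = max (height f) (height g) := by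
  induction f with
  | nil => simp [append, height]
  | cons a f s _ ih => simp [append, height, ih, max_assoc]

theorem height_of_hasTree {b : A} {x f : OrderedForest A} (h : HasTree b x f) :
    height x < height f := by
  induction f with
  | nil => exact h.elim
  | cons a f s _ ih =>
    rcases h with ⟨_, h⟩ | h
    · rw [height_rel h]; simp [height]
    · exact lt_of_lt_of_le (ih h) (le_max_right _ _)

theorem cons_rel_of_hasTree {b : A} {x f : OrderedForest A} (h : HasTree b x f) :
    Rel (cons b x f) f := by
  induction f with
  | nil => exact h.elim
  | cons a f s _ ih =>
    rcases h with ⟨rfl, h⟩ | h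
    · exact .trans (.cons b h (.refl _)) (.dup b f s)
    · exact .trans (.swap b a x f s) (.cons a (.refl f) (ih h))

theorem append_rel_of_forall {f g : OrderedForest A}
    (h : ∀ b x, HasTree b x f → HasTree b x g) : Rel (append f g) g := by
  induction f with
  | nil => exact .refl _
  | cons a f s _ ih =>
    have h₁ : Rel (append s g) g := ih fun b x k => h b x (Or.inr k)
    exact .trans (.cons a (.refl f) h₁)
      (cons_rel_of_hasTree (h a f (Or.inl ⟨rfl, .refl f⟩)))

theorem rel_of_forall {f g : OrderedForest A} (h : ∀ b x, HasTree b x f ↔ HasTree b x g) :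
    Rel f g :=
  .trans (.symm (append_rel_of_forall fun b x k => (h b x).2 k))
    (.trans (append_comm_rel g f) (append_rel_of_forall fun b x k => (h b x).1 k))

end OrderedForest

/-- The forests over `A`, without regard to order and multiplicity of siblings. -/
def Forest (A : Type u) : Type u := Quotient (OrderedForest.setoid A)

namespace Forest

variable {A : Type u}

/-- Union of forests. -/
instance : Add (Forest A) where
  add := Quotient.map₂ OrderedForest.append fun _ _ h _ _ k =>
    (OrderedForest.append_rel_right _ k).trans (OrderedForest.append_rel_left h _)

/-- The empty forest. -/
instance : Zero (Forest A) where
  zero := Quotient.mk _ OrderedForest.nil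

instance : AddCommMonoid (Forest A) where
  add_assoc f g h := by
    induction f, g, h using Quotient.inductionOn₃ with
    | _ f g h => exact congrArg (Quotient.mk _) (OrderedForest.append_assoc f g h)
  zero_add f := by
    induction f using Quotient.inductionOn with
    | _ f => rfl
  add_zero f := by
    induction f using Quotient.inductionOn with
    | _ f => exact congrArg (Quotient.mk _) (OrderedForest.append_nil f)
  add_comm f g := by
    induction f, g using Quotient.inductionOn₂ with
    | _ f g => exact Quotient.sound (OrderedForest.append_comm_rel f g)
  nsmul := nsmulRec

/-- The one-tree forest `a[f]`. -/
def tree (a : A) : Forest A → Forest A :=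
  Quotient.map (fun f => OrderedForest.cons a f OrderedForest.nil)
    fun _ _ h => OrderedForest.Rel.cons a h (.refl _)

/-- The path set `π(f)`. -/
def paths : Forest A → Set (List A) :=
  Quotient.lift OrderedForest.paths fun _ _ => OrderedForest.paths_rel

/-- Height of a forest. -/
def height : Forest A → ℕ :=
  Quotient.lift OrderedForest.height fun _ _ => OrderedForest.height_rel

theorem add_self (f : Forest A) : f + f = f := by
  induction f using Quotient.inductionOn with
  | _ f => exact Quotient.sound (OrderedForest.append_self_rel f)

theorem height_add (f g : Forest A) : height (f + g) = max (height f) (height g) := by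
  induction f, g using Quotient.inductionOn₂ with
  | _ f g => exact OrderedForest.height_append f g

theorem height_tree (a : A) (f : Forest A) : height (tree a f) = height f + 1 := by
  induction f using Quotient.inductionOn with
  | _ f => exact max_eq_left (Nat.zero_le _)

/-- A tree higher than everything else can be read off a forest. -/
theorem add_tree_inj {s t x y : Forest A} {a b : A} (h : s + tree a x = t + tree b y)
    (hsx : height s ≤ height x) (hsy : height s ≤ height y)
    (htx : height t ≤ height x) (hty : height t ≤ height y) : s = t ∧ a = b ∧ x = y := by
  induction s, t using Quotient.inductionOn₂ with
  | _ s t =>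
  induction x, y using Quotient.inductionOn₂ with
  | _ x y =>
  have h' : OrderedForest.Rel (s.append (.cons a x .nil)) (t.append (.cons b y .nil)) :=
    Quotient.exact h
  have key : ∀ c z, (OrderedForest.HasTree c z s ∨ c = a ∧ OrderedForest.Rel z x) ↔
      (OrderedForest.HasTree c z t ∨ c = b ∧ OrderedForest.Rel z y) := fun c z => by
    simpa [OrderedForest.hasTree_append, OrderedForest.HasTree] using
      OrderedForest.hasTree_rel c z h'
  have no : ∀ {w z : OrderedForest A} {c : A}, OrderedForest.height w ≤ OrderedForest.height z →
      ¬ OrderedForest.HasTree c z w := fun hw k =>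
    absurd (OrderedForest.height_of_hasTree k) (not_lt.2 hw)
  obtain ⟨hab, hxy⟩ := ((key a x).1 (Or.inr ⟨rfl, .refl _⟩)).resolve_left (no htx)
  subst hab
  refine ⟨Quotient.sound (OrderedForest.rel_of_forall fun c z => ?_), rfl, Quotient.sound hxy⟩
  constructor
  · intro k
    refine ((key c z).1 (Or.inl k)).resolve_right fun e => ?_
    have e₁ := OrderedForest.height_of_hasTree k
    rw [OrderedForest.height_rel e.2] at e₁
    exact absurd e₁ (not_lt.2 hsy)
  · intro k
    refine ((key c z).2 (Or.inl k)).resolve_right fun e => ?_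
    have e₁ := OrderedForest.height_of_hasTree k
    rw [OrderedForest.height_rel e.2] at e₁
    exact absurd e₁ (not_lt.2 htx)

end Forest

/-- Contexts over `A`, that is, forests in which exactly one leaf is a variable `□`:
`hole s` is `s + □`, and `node s a c` is `s + a[c]`. -/
inductive Context (A : Type u) : Type u
  | hole (s : Forest A) : Context A
  | node (s : Forest A) (a : A) (c : Context A) : Context A

namespace Context

variable {A : Type u}

/-- The context `f + c`. -/
def addForest (f : Forest A) : Context A → Context A
  | hole s => hole (f + s)
  | node s a c => node (f + s) a c

/-- The context obtained by replacing the variable of the first context by the second one. -/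
def comp : Context A → Context A → Context A
  | hole s, d => addForest s d
  | node s a c, d => node s a (comp c d)

/-- The forest obtained by replacing the variable of a context by a forest. -/
def subst : Context A → Forest A → Forest A
  | hole s, f => s + f
  | node s a c, f => s + Forest.tree a (subst c f)

theorem subst_addForest (g : Forest A) (c : Context A) (f : Forest A) :
    subst (addForest g c) f = g + subst c f := by
  cases c <;> exact add_assoc _ _ _

theorem subst_comp (c d : Context A) (f : Forest A) :
    subst (comp c d) f = subst c (subst d f) := by
  induction c with
  | hole s => exact subst_addForest s d f
  | node s a c ih => simp [comp, subst, ih]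

theorem height_le_subst (c : Context A) (f : Forest A) :
    Forest.height f ≤ Forest.height (subst c f) := by
  induction c with
  | hole s => simp [subst, Forest.height_add]
  | node s a c ih =>
    rw [subst, Forest.height_add, Forest.height_tree]
    exact le_trans ih (le_trans (Nat.le_succ _) (le_max_right _ _))

/-- A bound for the heights of the side forests of a context. -/
def bound : Context A → ℕ
  | hole s => Forest.height s
  | node s _ c => max (Forest.height s) (bound c)

theorem exists_height [Nonempty A] (n : ℕ) : ∃ f : Forest A, Forest.height f = n := by
  induction n with
  | zero => exact ⟨0, rfl⟩
  | succ n ih =>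
    obtain ⟨f, hf⟩ := ih
    exact ⟨Forest.tree (Classical.arbitrary A) f, by rw [Forest.height_tree, hf]⟩

theorem eq_of_subst_eq (a : A) (x : Forest A) (c d : Context A)
    (hc : bound c ≤ Forest.height x) (hd : bound d ≤ Forest.height x)
    (h : subst c (Forest.tree a x) = subst d (Forest.tree a x)) : c = d := by
  have big : ∀ e : Context A, Forest.height x < Forest.height (subst e (Forest.tree a x)) :=
    fun e => lt_of_lt_of_le (by rw [Forest.height_tree]; exact Nat.lt_succ_self _)
      (height_le_subst e _)
  induction c generalizing d with
  | hole s =>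
    cases d with
    | hole t => rw [(Forest.add_tree_inj h hc hc hd hd).1]
    | node t b d =>
      have hd' : Forest.height t ≤ Forest.height x := le_trans (le_max_left _ _) hd
      have e := (Forest.add_tree_inj h hc (le_trans hc (big d).le) hd'
        (le_trans hd' (big d).le)).2.2
      exact absurd (congrArg Forest.height e) (big d).ne
  | node s b c ih =>
    have hc' : Forest.height s ≤ Forest.height x := le_trans (le_max_left _ _) hc
    cases d with
    | hole t =>
      have e := (Forest.add_tree_inj h (le_trans hc' (big c).le) hc' (le_trans hd (big c).le)
        hd).2.2
      exact absurd (congrArg Forest.height e.symm) (big c).ne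
    | node t b' d =>
      have hd' : Forest.height t ≤ Forest.height x := le_trans (le_max_left _ _) hd
      obtain ⟨h₁, h₂, h₃⟩ := Forest.add_tree_inj h (le_trans hc' (big c).le)
        (le_trans hc' (big d).le) (le_trans hd' (big c).le) (le_trans hd' (big d).le)
      rw [h₁, h₂, ih d (le_trans (le_max_right _ _) hc) (le_trans (le_max_right _ _) hd) h₃]

theorem ext_subst (c d : Context A) (h : ∀ f, subst c f = subst d f) : c = d := by
  cases isEmpty_or_nonempty A with
  | inl hA =>
    have hF : ∀ s : Forest A, s = 0 := fun s => by
      induction s using Quotient.inductionOn with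
      | _ s =>
        cases s with
        | nil => rfl
        | cons a _ _ => exact hA.elim a
    cases c with
    | node _ a _ => exact hA.elim a
    | hole s =>
      cases d with
      | node _ a _ => exact hA.elim a
      | hole t => rw [hF s, hF t]
  | inr hA =>
    obtain ⟨x, hx⟩ := exists_height (A := A) (max (bound c) (bound d))
    exact eq_of_subst_eq (Classical.arbitrary A) x c d (hx ▸ le_max_left _ _)
      (hx ▸ le_max_right _ _) (h _)

instance : Monoid (Context A) where
  mul := comp
  one := hole 0
  mul_assoc c d e := ext_subst _ _ fun f => by
    change subst (comp (comp c d) e) f = subst (comp c (comp d e)) f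
    simp only [subst_comp]
  one_mul c := ext_subst _ _ fun f => by
    change subst (comp (hole 0) c) f = subst c f
    rw [subst_comp]
    exact zero_add _
  mul_one c := ext_subst _ _ fun f => by
    change subst (comp c (hole 0)) f = subst c f
    rw [subst_comp]
    exact congrArg (subst c) (zero_add f)

instance : MulAction (Context A) (Forest A) where
  smul := subst
  one_smul f := zero_add f
  mul_smul c d f := subst_comp c d f

end Context

namespace ForestAlgebra

/-- The free forest algebra `(H_A, V_A)` over the alphabet `A`. -/
def free (A : Type u) : ForestAlgebra.{u} where
  H := Forest A
  V := Context A
  faithful := Context.ext_subst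
  ins := Context.hole
  ins_smul _ _ := rfl
  exists_smul_zero f := ⟨Context.hole f, (add_zero f).symm⟩
  add_self := Forest.add_self

/-- 2-distributivity: for every finite alphabet `A`, every morphism `φ` from the free forest
algebra over `A`, every context `c` and all forests `f₁`, `f₂` with the same path sets,
`φ (c (f₁ + f₂)) = φ (c f₁ + c f₂)`. -/
def TwoDistributive (F : ForestAlgebra.{u}) : Prop :=
  ∀ (A : Type) [Finite A] (φ : Hom (free A) F) (c : Context A) (f₁ f₂ : Forest A),
    Forest.paths f₁ = Forest.paths f₂ → φ.onH (c • (f₁ + f₂)) = φ.onH (c • f₁ + c • f₂)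

end ForestAlgebra

/-! Addition is idempotent, so `H` is a semilattice and `x + h = h` reads as `x ≤ h`; most
equalities below are proved as two such absorptions.

From division to 2-distributivity: in a distributive algebra a forest is the sum of its paths, so
its value depends only on its path set (`Distributive.eval_eq_of_paths_eq`). Two forests with the
same paths thus have the same second coordinate in `F₁ ≀ F₂`. By idempotence, adding them leaves
that coordinate unchanged, so a wreath context acts on both forests and on their sum through one
context of `F₁`, which distributes (`wreath_smul_add`). The resulting identity passes to divisors,
because a morphism from a free algebra to the divisor can be computed in the wreath product.

Conversely, let `F₂` compute the path set of a forest and let `F₁` compute its annotated paths, in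
which each node also records the path set `P` below it. In a 2-distributive algebra this invariant
determines the value (`eval_eq_of_annotatedPaths_eq`): trees whose roots share an annotated label
`(a, P)` have children with equal path sets, so they may be merged into a single tree. After merging
there is one tree for each label, the annotated paths of its children can be read off from those of
the forest, and induction on the height applies. Hence evaluation in `F` of forests over the
alphabet `F.V` factors through the wreath product, and `divides_of_kernel` turns this into division.
-/

namespace ForestAlgebra

/-! ### Morphisms out of the free forest algebra -/

section Lift

variable {A : Type v} {G : ForestAlgebra.{u}}

theorem ins_add (h k : G.H) : G.ins (h + k) = G.ins h * G.ins k :=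
  G.faithful _ _ fun x => by rw [mul_smul, G.ins_smul, G.ins_smul, G.ins_smul, add_assoc]

theorem ins_zero : G.ins 0 = 1 :=
  G.faithful _ _ fun x => by rw [G.ins_smul, zero_add, one_smul]

/-- The value of an ordered forest under an interpretation of the letters. -/
def eval (u : A → G.V) : OrderedForest A → G.H
  | .nil => 0
  | .cons a f s => u a • eval u f + eval u s

theorem eval_append (u : A → G.V) (f g : OrderedForest A) :
    eval u (f.append g) = eval u f + eval u g := by
  induction f with
  | nil => exact (zero_add _).symm
  | cons a f s _ ih => simp only [OrderedForest.append, eval, ih, add_assoc]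

theorem eval_rel (u : A → G.V) {f g : OrderedForest A} (h : OrderedForest.Rel f g) :
    eval u f = eval u g := by
  induction h with
  | refl f => rfl
  | symm _ ih => exact ih.symm
  | trans _ _ ih₁ ih₂ => exact ih₁.trans ih₂
  | cons a _ _ ih₁ ih₂ => simp only [eval, ih₁, ih₂]
  | swap a b f g s => exact add_left_comm _ _ _
  | dup a f s => simp only [eval]; rw [← add_assoc, G.add_self]

/-- The value of a forest under an interpretation of the letters. -/
def evalForest (u : A → G.V) : Forest A →+ G.H where
  toFun := Quotient.lift (eval u) fun _ _ => eval_rel u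
  map_zero' := rfl
  map_add' f g := by
    induction f, g using Quotient.inductionOn₂ with
    | _ f g => exact eval_append u f g

theorem evalForest_tree (u : A → G.V) (a : A) (f : Forest A) :
    evalForest u (Forest.tree a f) = u a • evalForest u f := by
  induction f using Quotient.inductionOn with
  | _ f => exact add_zero _

/-- The value of a context under an interpretation of the letters. -/
def evalContext (u : A → G.V) : Context A → G.V
  | .hole s => G.ins (evalForest u s)
  | .node s a c => G.ins (evalForest u s) * u a * evalContext u c

theorem evalContext_addForest (u : A → G.V) (f : Forest A) (c : Context A) :
    evalContext u (c.addForest f) = G.ins (evalForest u f) * evalContext u c := by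
  cases c <;> simp only [Context.addForest, evalContext, map_add, ins_add, mul_assoc]

theorem evalContext_comp (u : A → G.V) (c d : Context A) :
    evalContext u (c.comp d) = evalContext u c * evalContext u d := by
  induction c with
  | hole s => exact evalContext_addForest u s d
  | node s a c ih => simp only [Context.comp, evalContext, ih, mul_assoc]

theorem evalForest_subst (u : A → G.V) (c : Context A) (f : Forest A) :
    evalForest u (c.subst f) = evalContext u c • evalForest u f := by
  induction c with
  | hole s => simp only [Context.subst, evalContext, map_add, G.ins_smul]
  | node s a c ih =>
    simp only [Context.subst, evalContext, map_add, evalForest_tree, ih, mul_smul, G.ins_smul]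

/-- The morphism from the free forest algebra that extends an interpretation of the letters. -/
def lift (u : A → G.V) : Hom (free A) G where
  onH := evalForest u
  onV :=
    { toFun := evalContext u
      map_one' := (congrArg G.ins (map_zero (evalForest u))).trans ins_zero
      map_mul' := evalContext_comp u }
  map_smul := evalForest_subst u
  map_ins _ := rfl

theorem evalContext_letter (u : A → G.V) (a : A) :
    evalContext u (.node 0 a (.hole 0)) = u a := by
  simp only [evalContext, map_zero, ins_zero, one_mul, mul_one]

end Lift

/-! ### Divisors of wreath products of distributive algebras -/

section Distributive

variable {A : Type v} {G : ForestAlgebra.{u}}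

theorem absorb_of_add {h x y : G.H} (e : x + y + h = h) : x + h = h := by
  rw [← e, add_assoc, ← add_assoc x x, G.add_self]

/-- The value of the path with the given label word. -/
def evalPath (u : A → G.V) : List A → G.H
  | [] => 0
  | a :: p => u a • evalPath u p

theorem Distributive.smul_absorb (hG : G.Distributive) (x : G.V) {h k : G.H} (e : h + k = k) :
    x • h + x • k = x • k := by
  rw [← hG, e]

/-- Contexts of a distributive algebra are monotone, so following a path downwards through the
forest only decreases the value. -/
theorem Distributive.evalPath_absorb (hG : G.Distributive) (u : A → G.V) {f : OrderedForest A}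
    {p : List A} (hp : p ∈ f.paths) : evalPath u p + eval u f = eval u f := by
  induction f generalizing p with
  | nil =>
    obtain rfl : p = [] := hp
    exact zero_add _
  | cons a f s ihf ihs =>
    rcases hp with ⟨q, hq, rfl⟩ | hp
    · simp only [evalPath, eval]
      rw [← add_assoc, hG.smul_absorb (u a) (ihf hq)]
    · simp only [eval]
      rw [add_left_comm, ihs hp]

/-- Distributing at every node splits the value into those of paths. The context `x` accumulates the
labels read so far, which makes the induction go through. -/
theorem Distributive.eval_absorb (hG : G.Distributive) (u : A → G.V) (f : OrderedForest A)
    (x : G.V) (h : G.H) (hx : ∀ p ∈ f.paths, x • evalPath u p + h = h) :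
    x • eval u f + h = h := by
  induction f generalizing x with
  -- `x • 0` need not be `0`; the empty path accounts for it.
  | nil => exact hx [] rfl
  | cons a f s ihf ihs =>
    simp only [eval]
    rw [hG, add_assoc, ihs x fun p hp => hx p (Or.inr hp), ← mul_smul]
    refine ihf _ fun p hp => ?_
    rw [mul_smul]
    exact hx (a :: p) (Or.inl ⟨p, hp, rfl⟩)

theorem Distributive.eval_eq_of_paths_eq (hG : G.Distributive) (u : A → G.V)
    {f g : OrderedForest A} (h : f.paths = g.paths) : eval u f = eval u g := by
  have le : ∀ {f g : OrderedForest A}, f.paths = g.paths → eval u f + eval u g = eval u g := by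
    intro f g h
    have := hG.eval_absorb u f 1 (eval u g) fun p hp => by
      rw [one_smul]
      exact hG.evalPath_absorb u (h ▸ hp)
    rwa [one_smul] at this
  rw [← le h, add_comm, le h.symm]

theorem Distributive.evalForest_eq_of_paths_eq (hG : G.Distributive) (u : A → G.V)
    {f g : Forest A} (h : f.paths = g.paths) : evalForest u f = evalForest u g := by
  induction f, g using Quotient.inductionOn₂ with
  | _ f g => exact hG.eval_eq_of_paths_eq u h

/-! ### Identities in wreath products and their divisors -/

/-- The second coordinate of the wreath product, as a morphism. -/
def wreathSnd (F₁ : ForestAlgebra.{u}) (F₂ : ForestAlgebra.{v}) : Hom (wreath F₁ F₂) F₂ where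
  onH := AddMonoidHom.snd F₁.H F₂.H
  onV := { toFun := WreathV.ctx, map_one' := rfl, map_mul' := fun _ _ => rfl }
  map_smul _ _ := rfl
  map_ins _ := rfl

theorem Hom.onH_eval {G' : ForestAlgebra.{u}} (θ : Hom G G') (u : A → G.V)
    (f : OrderedForest A) : θ.onH (eval u f) = eval (fun a => θ.onV (u a)) f := by
  induction f with
  | nil => exact map_zero _
  | cons a f s ihf ihs => simp only [eval, map_add, θ.map_smul, ihf, ihs]

theorem Hom.onH_evalForest {G' : ForestAlgebra.{u}} (θ : Hom G G') (u : A → G.V)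
    (f : Forest A) : θ.onH (evalForest u f) = evalForest (fun a => θ.onV (u a)) f := by
  induction f using Quotient.inductionOn with
  | _ f => exact θ.onH_eval u f

/-- In the wreath product of two distributive algebras, contexts distribute over forests with the
same second coordinate. -/
theorem wreath_smul_add {F₁ : ForestAlgebra.{u}} {F₂ : ForestAlgebra.{v}} (h₁ : F₁.Distributive)
    (x : (wreath F₁ F₂).V) (h k : (wreath F₁ F₂).H)
    (e : (wreathSnd F₁ F₂).onH h = (wreathSnd F₁ F₂).onH k) :
    x • (h + k) = x • h + x • k := by
  obtain ⟨a, b⟩ := h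
  obtain ⟨a', b'⟩ := k
  obtain rfl : b = b' := e
  refine Prod.ext ?_ ?_
  -- Since `b + b = b`, the same context `x.fn b` of `F₁` acts in all three terms.
  · change x.fn (b + b) • (a + a') = x.fn b • a + x.fn b • a'
    rw [F₂.add_self, h₁]
  · change x.ctx • (b + b) = x.ctx • b + x.ctx • b
    rw [F₂.add_self, F₂.add_self]

/-- Freeness: once the letters are lifted through `β`, evaluating in `G` and then applying `α`
agrees with `φ` on letters, hence on all forests. Membership is part of the claim because `α` lives
on `S.setH` only. -/
theorem hom_free_eq_of_divides {F : ForestAlgebra.{u}} (φ : Hom (free A) F) (S : Subalgebra G)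
    (α : S.setH →+ F.H) (β : S.setV →* F.V)
    (hαβ : ∀ (x : S.setV) (h : S.setH),
      α ⟨(x : G.V) • (h : G.H), S.smul_mem x x.2 h h.2⟩ = β x • α h)
    (u : A → S.setV) (hu : ∀ a, β (u a) = φ.onV (.node 0 a (.hole 0))) (f : Forest A) :
    ∃ hf : evalForest (fun a => (u a : G.V)) f ∈ S.setH, α ⟨_, hf⟩ = φ.onH f := by
  induction f using Quotient.inductionOn with
  | _ f =>
    change ∃ hf : eval (fun a => (u a : G.V)) f ∈ S.setH, α ⟨_, hf⟩ = φ.onH _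
    induction f with
    | nil => exact ⟨S.setH.zero_mem, (map_zero α).trans (map_zero φ.onH).symm⟩
    | cons a f s ihf ihs =>
      obtain ⟨hf, ef⟩ := ihf
      obtain ⟨hs, es⟩ := ihs
      refine ⟨S.setH.add_mem (S.smul_mem _ (u a).2 _ hf) hs, ?_⟩
      have e₁ := map_add α ⟨_, S.smul_mem _ (u a).2 _ hf⟩ ⟨_, hs⟩
      have e₂ := hαβ (u a) ⟨_, hf⟩
      refine e₁.trans ?_
      rw [e₂, ef, es, hu]
      -- The context `a[□]` applied to `f`, plus `s`, is `cons a f s` by definition.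
      exact (congrArg (· + φ.onH _) (φ.map_smul (Context.node 0 a (Context.hole 0)) _)).symm.trans
        (map_add φ.onH _ _).symm

theorem twoDistributive_of_divides {F F₁ F₂ : ForestAlgebra.{u}} (h₁ : F₁.Distributive)
    (h₂ : F₂.Distributive) (h : F.Divides (wreath F₁ F₂)) : F.TwoDistributive := by
  obtain ⟨S, α, β, -, hβ, hαβ, -⟩ := h
  intro A _ φ c f₁ f₂ hf
  choose u hu using fun a : A => hβ (φ.onV (Context.node 0 a (Context.hole 0)))
  have key : evalForest (fun a => (u a : (wreath F₁ F₂).V)) (c • (f₁ + f₂)) =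
      evalForest (fun a => (u a : (wreath F₁ F₂).V)) (c • f₁ + c • f₂) := by
    change evalForest _ (c.subst (f₁ + f₂)) = evalForest _ (c.subst f₁ + c.subst f₂)
    simp only [map_add, evalForest_subst]
    refine wreath_smul_add h₁ _ _ _ ?_
    rw [Hom.onH_evalForest, Hom.onH_evalForest]
    exact h₂.evalForest_eq_of_paths_eq _ hf
  obtain ⟨m₁, e₁⟩ := hom_free_eq_of_divides φ S α β hαβ u hu (c • (f₁ + f₂))
  obtain ⟨m₂, e₂⟩ := hom_free_eq_of_divides φ S α β hαβ u hu (c • f₁ + c • f₂)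
  refine e₁.symm.trans (Eq.trans ?_ e₂)
  exact congrArg α (Subtype.ext key)

end Distributive

/-! ### Division from inclusion of kernels -/

/-- The image of `ψ` is a subalgebra of `G`, and `φ` factors through it. The maps are defined by
arbitrary preimages, a choice that the kernel inclusion makes immaterial. -/
theorem divides_of_kernel {E F G : ForestAlgebra.{u}} (φ : Hom E F) (ψ : Hom E G)
    (hH : Function.Surjective φ.onH) (hV : Function.Surjective φ.onV)
    (ker : ∀ f g, ψ.onH f = ψ.onH g → φ.onH f = φ.onH g) : F.Divides G := by
  -- The inclusion for contexts follows from that for forests, because `F` is faithful and `φ.onH`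
  -- is surjective.
  have kerV : ∀ c d, ψ.onV c = ψ.onV d → φ.onV c = φ.onV d := fun c d e =>
    F.faithful _ _ fun h => by
      obtain ⟨f, rfl⟩ := hH h
      rw [← φ.map_smul, ← φ.map_smul]
      exact ker _ _ (by rw [ψ.map_smul, ψ.map_smul, e])
  let S : Subalgebra G :=
    { setH := AddMonoidHom.mrange ψ.onH
      setV := MonoidHom.mrange ψ.onV
      smul_mem := by
        rintro _ ⟨x, rfl⟩ _ ⟨h, rfl⟩
        exact ⟨x • h, ψ.map_smul x h⟩
      ins_mem := by
        rintro _ ⟨h, rfl⟩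
        exact ⟨E.ins h, ψ.map_ins h⟩ }
  choose pH hpH using fun h : S.setH => h.2
  choose pV hpV using fun x : S.setV => x.2
  let α : S.setH →+ F.H :=
    { toFun := fun h => φ.onH (pH h)
      map_zero' := by
        rw [← map_zero φ.onH]
        exact ker _ _ ((hpH 0).trans (map_zero ψ.onH).symm)
      map_add' := fun h k => by
        rw [← map_add]
        refine ker _ _ ((hpH _).trans ?_)
        rw [map_add, hpH, hpH]
        rfl }
  let β : S.setV →* F.V :=
    { toFun := fun x => φ.onV (pV x)
      map_one' := by
        rw [← map_one φ.onV]
        exact kerV _ _ ((hpV 1).trans (map_one ψ.onV).symm)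
      map_mul' := fun x y => by
        rw [← map_mul]
        refine kerV _ _ ((hpV _).trans ?_)
        rw [map_mul, hpV, hpV]
        rfl }
  refine ⟨S, α, β, fun h => ?_, fun x => ?_, fun x h => ?_, fun h => ?_⟩
  · obtain ⟨f, rfl⟩ := hH h
    exact ⟨⟨ψ.onH f, f, rfl⟩, ker _ _ (hpH _)⟩
  · obtain ⟨c, rfl⟩ := hV x
    exact ⟨⟨ψ.onV c, c, rfl⟩, kerV _ _ (hpV _)⟩
  · change φ.onH (pH _) = φ.onV (pV x) • φ.onH (pH h)
    rw [← φ.map_smul]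
    refine ker _ _ ((hpH _).trans ?_)
    rw [ψ.map_smul, hpV, hpH]
  · change φ.onV (pV _) = F.ins (φ.onH (pH h))
    rw [← φ.map_ins]
    refine kerV _ _ ((hpV _).trans ?_)
    rw [ψ.map_ins, hpH]

/-! ### The distributive algebra of a semilattice -/

/-- The join-preserving self-maps of a join-semilattice. -/
def joinMaps (L : Type u) [SemilatticeSup L] : Submonoid (Function.End L) where
  carrier := {g | ∀ x y, g (x ⊔ y) = g x ⊔ g y}
  one_mem' _ _ := rfl
  mul_mem' {g k} hg hk x y := by
    change g (k (x ⊔ y)) = g (k x) ⊔ g (k y)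
    rw [hk, hg]

/-- A semilattice with all its join-preserving self-maps. -/
def ofSemilattice (L : Type u) [SemilatticeSup L] [OrderBot L] : ForestAlgebra.{u} where
  H := L
  V := joinMaps L
  addCommMonoidH :=
    { add := (· ⊔ ·)
      zero := ⊥
      add_assoc := sup_assoc
      zero_add := bot_sup_eq
      add_zero := sup_bot_eq
      add_comm := sup_comm
      nsmul := @nsmulRec L ⟨⊥⟩ ⟨(· ⊔ ·)⟩ }
  faithful _ _ h := Subtype.ext (funext h)
  -- Only binary joins have to be preserved: this map moves `⊥` unless `h = ⊥`, and `letter` moves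
  -- it too.
  ins h := ⟨fun x => h ⊔ x, sup_sup_distrib_left h⟩
  ins_smul _ _ := rfl
  exists_smul_zero h := ⟨⟨fun x => h ⊔ x, sup_sup_distrib_left h⟩, (sup_bot_eq h).symm⟩
  add_self := sup_idem

theorem ofSemilattice_distributive (L : Type u) [SemilatticeSup L] [OrderBot L] :
    (ofSemilattice L).Distributive :=
  fun x => x.2

/-- Prefixing a set of nonempty paths by a root labelled `b`. -/
def prefixMap {B : Type u} (b : B) (X : Set (List B)) : Set (List B) :=
  {[b]} ∪ List.cons b '' X

/-- `prefixMap` as a context. -/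
def letter {B : Type u} (b : B) : (ofSemilattice (Set (List B))).V :=
  ⟨prefixMap b, fun X Y => by
    change {[b]} ∪ List.cons b '' (X ∪ Y) = ({[b]} ∪ List.cons b '' X) ∪ ({[b]} ∪ List.cons b '' Y)
    rw [Set.image_union, Set.union_union_distrib_left]⟩

/-! ### 2-distributivity over arbitrary alphabets -/

section TwoDistributive

variable {A : Type v} {F : ForestAlgebra.{u}}

/-- Relabelling of ordered forests. -/
def relabel {T : Type*} (ρ : A → T) : OrderedForest A → OrderedForest T
  | .nil => .nil
  | .cons a f s => .cons (ρ a) (relabel ρ f) (relabel ρ s)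

theorem paths_relabel {T : Type*} (ρ : A → T) (f : OrderedForest A) :
    (relabel ρ f).paths = List.map ρ '' f.paths := by
  induction f with
  | nil => simp [relabel, OrderedForest.paths]
  | cons a f s ihf ihs =>
    simp only [relabel, OrderedForest.paths, ihf, ihs, Set.image_union, Set.image_image,
      List.map_cons]

/-- The letters of an ordered forest. -/
def letters : OrderedForest A → Set A
  | .nil => ∅
  | .cons a f s => insert a (letters f ∪ letters s)

theorem finite_letters (f : OrderedForest A) : (letters f).Finite := by
  induction f with
  | nil => exact Set.finite_empty
  | cons a f s ihf ihs => exact (ihf.union ihs).insert a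

theorem eval_relabel {T : Type*} (u : A → F.V) (w : T → F.V) (ρ : A → T) (f : OrderedForest A)
    (h : ∀ a ∈ letters f, w (ρ a) = u a) : eval w (relabel ρ f) = eval u f := by
  induction f with
  | nil => rfl
  | cons a f s ihf ihs =>
    simp only [relabel, eval]
    rw [h a (Or.inl rfl), ihf fun b hb => h b (Or.inr (Or.inl hb)),
      ihs fun b hb => h b (Or.inr (Or.inr hb))]

/-- The definition of 2-distributivity speaks of finite alphabets only, but two forests use finitely
many letters, and relabelling preserves equality of path sets. -/
theorem TwoDistributive.smul_add (hF : F.TwoDistributive) (u : A → F.V) (x : F.V)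
    {f g : OrderedForest A} (h : f.paths = g.paths) :
    x • (eval u f + eval u g) = x • eval u f + x • eval u g := by
  classical
  have fin : (letters f ∪ letters g).Finite := (finite_letters f).union (finite_letters g)
  have := fin.to_subtype
  obtain ⟨n, ⟨e⟩⟩ := Finite.exists_equiv_fin ↥(letters f ∪ letters g)
  -- The extra letter `none` is interpreted as the context `x`; letters sent to it by `ρ` occur in
  -- neither forest.
  let ρ : A → Option (Fin n) := fun a =>
    if ha : a ∈ letters f ∪ letters g then some (e ⟨a, ha⟩) else none
  let w : Option (Fin n) → F.V := fun o => o.elim x fun i => u (e.symm i)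
  have hρ : ∀ a ∈ letters f ∪ letters g, w (ρ a) = u a := fun a ha => by
    change (ρ a).elim x _ = _
    rw [show ρ a = some (e ⟨a, ha⟩) from dif_pos ha]
    exact congrArg (fun z : ↥(letters f ∪ letters g) => u z) (e.symm_apply_apply _)
  have hf := eval_relabel u w ρ f fun a ha => hρ a (Or.inl ha)
  have hg := eval_relabel u w ρ g fun a ha => hρ a (Or.inr ha)
  let f' : Forest (Option (Fin n)) := Quotient.mk _ (relabel ρ f)
  let g' : Forest (Option (Fin n)) := Quotient.mk _ (relabel ρ g)
  let c : Context (Option (Fin n)) := .node 0 none (.hole 0)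
  have paths_eq : f'.paths = g'.paths := by
    change (relabel ρ f).paths = (relabel ρ g).paths
    rw [paths_relabel, paths_relabel, h]
  have key : evalForest w (c.subst (f' + g')) = evalForest w (c.subst f' + c.subst g') :=
    hF _ (lift w) c f' g' paths_eq
  rw [map_add, evalForest_subst, evalForest_subst, evalForest_subst, evalContext_letter,
    map_add] at key
  rw [← hf, ← hg]
  exact key

end TwoDistributive

/-! ### Path sets with path set labels -/

section Annotated

variable {A : Type u}

/-- The nonempty paths of an ordered forest. -/
def nonemptyPaths : OrderedForest A → Set (List A)
  | .nil => ∅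
  | .cons a f s => prefixMap a (nonemptyPaths f) ∪ nonemptyPaths s

/-- The empty path carries no information. Dropping it makes the empty forest correspond to `∅`, the
zero of the semilattice. -/
theorem paths_eq_insert (f : OrderedForest A) : f.paths = insert [] (nonemptyPaths f) := by
  induction f with
  | nil => simp [OrderedForest.paths, nonemptyPaths]
  | cons a f s ihf ihs =>
    simp only [OrderedForest.paths, nonemptyPaths, prefixMap, ihf, ihs, Set.image_insert_eq,
      Set.union_insert, Set.insert_union, Set.singleton_union]

theorem nonemptyPaths_append (f g : OrderedForest A) :
    nonemptyPaths (f.append g) = nonemptyPaths f ∪ nonemptyPaths g := by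
  induction f with
  | nil => exact (Set.empty_union _).symm
  | cons a f s _ ih => simp only [OrderedForest.append, nonemptyPaths, ih, Set.union_assoc]

/-- The nonempty paths of an ordered forest in which every node is labelled, in addition, by the
set of paths below it. -/
def annotatedPaths : OrderedForest A → Set (List (A × Set (List A)))
  | .nil => ∅
  | .cons a f s => prefixMap (a, nonemptyPaths f) (annotatedPaths f) ∪ annotatedPaths s

theorem nil_notMem_annotatedPaths (f : OrderedForest A) : [] ∉ annotatedPaths f := by
  induction f with
  | nil => exact Set.notMem_empty _
  | cons a f s _ ih => simp [annotatedPaths, prefixMap, ih]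

theorem annotatedPaths_append (f g : OrderedForest A) :
    annotatedPaths (f.append g) = annotatedPaths f ∪ annotatedPaths g := by
  induction f with
  | nil => exact (Set.empty_union _).symm
  | cons a f s _ ih => simp only [OrderedForest.append, annotatedPaths, ih, Set.union_assoc]

theorem mem_annotatedPaths_cons (a : A) (f s : OrderedForest A) (b : A × Set (List A))
    (w : List (A × Set (List A))) :
    b :: w ∈ annotatedPaths (.cons a f s) ↔
      (b = (a, nonemptyPaths f) ∧ (w = [] ∨ w ∈ annotatedPaths f)) ∨
        b :: w ∈ annotatedPaths s := by
  simp only [annotatedPaths, prefixMap, Set.mem_union, Set.mem_singleton_iff, Set.mem_image,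
    List.cons.injEq]
  constructor
  · rintro ((⟨rfl, rfl⟩ | ⟨x, hx, rfl, rfl⟩) | h)
    · exact Or.inl ⟨rfl, Or.inl rfl⟩
    · exact Or.inl ⟨rfl, Or.inr hx⟩
    · exact Or.inr h
  · rintro (⟨rfl, rfl | h⟩ | h)
    · exact Or.inl (Or.inl ⟨rfl, rfl⟩)
    · exact Or.inl (Or.inr ⟨w, h, rfl, rfl⟩)
    · exact Or.inr h

/-! ### Merging the trees whose roots share an annotated label -/

open Classical in
/-- The union of the forests below the roots with the annotated label `b`. -/
noncomputable def below (b : A × Set (List A)) : OrderedForest A → OrderedForest A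
  | .nil => .nil
  | .cons a f s => if b = (a, nonemptyPaths f) then f.append (below b s) else below b s

theorem below_cons_self (a : A) (f s : OrderedForest A) :
    below (a, nonemptyPaths f) (.cons a f s) = f.append (below (a, nonemptyPaths f) s) :=
  if_pos rfl

theorem below_cons_of_ne {b : A × Set (List A)} {a : A} {f : OrderedForest A}
    (h : b ≠ (a, nonemptyPaths f)) (s : OrderedForest A) :
    below b (.cons a f s) = below b s :=
  if_neg h

theorem singleton_mem_cons_of_ne {b : A × Set (List A)} {a : A} {f : OrderedForest A}
    (h : b ≠ (a, nonemptyPaths f)) (s : OrderedForest A) :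
    [b] ∈ annotatedPaths (.cons a f s) ↔ [b] ∈ annotatedPaths s := by
  simp [mem_annotatedPaths_cons, h]

/-- `[b] ∈ annotatedPaths f` expresses that some root of `f` has the annotated label `b`. -/
theorem below_eq_nil {b : A × Set (List A)} {f : OrderedForest A}
    (h : [b] ∉ annotatedPaths f) : below b f = .nil := by
  induction f with
  | nil => rfl
  | cons a f s _ ih =>
    rw [mem_annotatedPaths_cons] at h
    push Not at h
    have hb : b ≠ (a, nonemptyPaths f) := fun e => (h.1 e).1 rfl
    rw [below_cons_of_ne hb, ih h.2]

/-- Each of the merged forests has the path set `b.2`, and there is at least one of them. -/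
theorem nonemptyPaths_below {b : A × Set (List A)} {f : OrderedForest A}
    (h : [b] ∈ annotatedPaths f) : nonemptyPaths (below b f) = b.2 := by
  induction f with
  | nil => exact h.elim
  | cons a f s _ ih =>
    by_cases hb : b = (a, nonemptyPaths f)
    · subst hb
      rw [below_cons_self, nonemptyPaths_append]
      by_cases hs : [(a, nonemptyPaths f)] ∈ annotatedPaths s
      · rw [ih hs, Set.union_self]
      · rw [below_eq_nil hs]
        exact Set.union_empty _
    · rw [below_cons_of_ne hb]
      exact ih ((singleton_mem_cons_of_ne hb s).1 h)

/-- The invariant of the merged forest depends only on the invariant of `f`, which is what drives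
the induction on height. The word `[]` is excluded because `[b]` itself ends at a root. -/
theorem annotatedPaths_below (b : A × Set (List A)) (f : OrderedForest A) :
    annotatedPaths (below b f) = {w | w ≠ [] ∧ b :: w ∈ annotatedPaths f} := by
  induction f with
  | nil => simp [below, annotatedPaths]
  | cons a f s _ ih =>
    ext w
    by_cases hb : b = (a, nonemptyPaths f)
    · subst hb
      rw [below_cons_self, annotatedPaths_append, ih]
      simp only [Set.mem_union, Set.mem_ofPred_eq, mem_annotatedPaths_cons]
      have : w ∈ annotatedPaths f → w ≠ [] := fun h e => nil_notMem_annotatedPaths f (e ▸ h)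
      tauto
    · rw [below_cons_of_ne hb, ih]
      simp [mem_annotatedPaths_cons, hb]

theorem height_below (b : A × Set (List A)) (f : OrderedForest A) :
    (below b f).height ≤ f.height - 1 := by
  induction f with
  | nil => exact le_rfl
  | cons a f s _ ih =>
    by_cases hb : b = (a, nonemptyPaths f)
    · subst hb
      rw [below_cons_self, OrderedForest.height_append, OrderedForest.height]
      omega
    · rw [below_cons_of_ne hb, OrderedForest.height]
      omega

theorem height_pos_of_mem {w : List (A × Set (List A))} {f : OrderedForest A}
    (h : w ∈ annotatedPaths f) : 0 < f.height := by
  cases f with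
  | nil => exact h.elim
  | cons a f s => exact lt_of_lt_of_le (Nat.succ_pos _) (le_max_left _ _)

/-! ### Evaluation in a 2-distributive algebra -/

variable {F : ForestAlgebra.{v}}

/-- Here 2-distributivity enters: both forests have the path set recorded in the label. Without `hs`
the second one would be empty and contribute a spurious `u a • 0`. -/
theorem smul_eval_below_cons (hF : F.TwoDistributive) (u : A → F.V)
    (a : A) (f : OrderedForest A) {s : OrderedForest A}
    (hs : [(a, nonemptyPaths f)] ∈ annotatedPaths s) :
    u a • eval u (below (a, nonemptyPaths f) (.cons a f s)) =
      u a • eval u f + u a • eval u (below (a, nonemptyPaths f) s) := by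
  rw [below_cons_self, eval_append]
  refine hF.smul_add u (u a) ?_
  rw [paths_eq_insert, paths_eq_insert, nonemptyPaths_below hs]

/-- With `eval_absorb_of_below`, this makes the value of `f` the least upper bound of the values of
its merged trees, one for each root label. -/
theorem smul_eval_below_absorb (hF : F.TwoDistributive) (u : A → F.V)
    {b : A × Set (List A)} {f : OrderedForest A}
    (h : [b] ∈ annotatedPaths f) : u b.1 • eval u (below b f) + eval u f = eval u f := by
  induction f with
  | nil => exact h.elim
  | cons a f s _ ih =>
    by_cases hb : b = (a, nonemptyPaths f)
    · subst hb
      by_cases hs : [(a, nonemptyPaths f)] ∈ annotatedPaths s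
      · rw [smul_eval_below_cons hF u a f hs, eval, add_add_add_comm, F.add_self, ih hs]
      · rw [below_cons_self, below_eq_nil hs, OrderedForest.append_nil, eval, ← add_assoc,
          F.add_self]
    · rw [below_cons_of_ne hb, eval, add_left_comm,
        ih ((singleton_mem_cons_of_ne hb s).1 h)]

theorem eval_absorb_of_below (hF : F.TwoDistributive) (u : A → F.V)
    {f : OrderedForest A} {h : F.H}
    (hf : ∀ b, [b] ∈ annotatedPaths f → u b.1 • eval u (below b f) + h = h) :
    eval u f + h = h := by
  induction f with
  | nil => exact zero_add h
  | cons a f s _ ih =>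
    have h₀ := hf (a, nonemptyPaths f)
      ((mem_annotatedPaths_cons _ _ _ _ _).2 (Or.inl ⟨rfl, Or.inl rfl⟩))
    -- The merged tree lies below `h`; if `s` has a root with the same label, it is a sum, and both
    -- summands lie below `h`.
    have key : u a • eval u f + h = h ∧ ([(a, nonemptyPaths f)] ∈ annotatedPaths s →
        u a • eval u (below (a, nonemptyPaths f) s) + h = h) := by
      by_cases hs : [(a, nonemptyPaths f)] ∈ annotatedPaths s
      · rw [smul_eval_below_cons hF u a f hs] at h₀
        refine ⟨absorb_of_add h₀, fun _ => ?_⟩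
        rw [add_comm (u a • eval u f)] at h₀
        exact absorb_of_add h₀
      · rw [below_cons_self, below_eq_nil hs, OrderedForest.append_nil] at h₀
        exact ⟨h₀, fun k => absurd k hs⟩
    rw [eval, add_assoc, ih, key.1]
    intro b hb
    by_cases e : b = (a, nonemptyPaths f)
    · subst e
      exact key.2 hb
    · rw [← below_cons_of_ne e s]
      exact hf b ((singleton_mem_cons_of_ne e s).2 hb)

/-- The value of a forest in a 2-distributive algebra is determined by its annotated paths. -/
theorem eval_eq_of_annotatedPaths_eq (hF : F.TwoDistributive) (u : A → F.V)
    (f g : OrderedForest A)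
    (h : annotatedPaths f = annotatedPaths g) : eval u f = eval u g := by
  -- Structural induction would not do: `below b f` joins the children of several roots and is in
  -- general no subterm of `f`.
  induction hn : f.height using Nat.strong_induction_on generalizing f g with
  | _ n ih =>
    have key : ∀ b, [b] ∈ annotatedPaths f → eval u (below b f) = eval u (below b g) :=
      fun b hb => by
        have h₁ := height_below b f
        have h₂ := height_pos_of_mem hb
        exact ih _ (by omega) _ _ (by rw [annotatedPaths_below, annotatedPaths_below, h]) rfl
    have h₁ : eval u f + eval u g = eval u g := eval_absorb_of_below hF u fun b hb => by
      rw [key b hb]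
      exact smul_eval_below_absorb hF u (h ▸ hb)
    have h₂ : eval u g + eval u f = eval u f := eval_absorb_of_below hF u fun b hb => by
      rw [← key b (h ▸ hb)]
      exact smul_eval_below_absorb hF u (h ▸ hb)
    rw [← h₁, add_comm, h₂]

end Annotated

/-! ### 2-distributive algebras divide wreath products -/

/-- The letters as contexts of the wreath product of the algebras of annotated paths and of
paths. -/
def annotatedLetter {A : Type u} (a : A) :
    (wreath (ofSemilattice (Set (List (A × Set (List A)))))
      (ofSemilattice (Set (List A)))).V :=
  WreathV.mk (F₁ := ofSemilattice (Set (List (A × Set (List A)))))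
    (F₂ := ofSemilattice (Set (List A))) (fun P => letter (a, P)) (letter a)

/-- At a node, the second coordinate is the path set of the children, which is exactly what the
first coordinate needs to form the annotated label. -/
theorem eval_annotatedLetter {A : Type u} (f : OrderedForest A) :
    eval annotatedLetter f = (annotatedPaths f, nonemptyPaths f) := by
  induction f with
  | nil => rfl
  | cons a f s ihf ihs => rw [eval, ihf, ihs]; rfl

theorem TwoDistributive.divides_wreath {F : ForestAlgebra.{u}} (hF : F.TwoDistributive) :
    F.Divides (wreath (ofSemilattice (Set (List (F.V × Set (List F.V)))))
      (ofSemilattice (Set (List F.V)))) := by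
  refine divides_of_kernel (lift (id : F.V → F.V)) (lift annotatedLetter)
    (fun h => ?_)
    (fun x => ⟨Context.node 0 x (Context.hole 0), evalContext_letter id x⟩) fun f g => ?_
  -- Every context of `F` is a letter, so `h = x • 0` is the value of a one-node tree.
  · obtain ⟨x, rfl⟩ := F.exists_smul_zero h
    exact ⟨Forest.tree x 0, evalForest_tree id x 0⟩
  · induction f, g using Quotient.inductionOn₂ with
    | _ f g =>
      intro e
      change eval annotatedLetter f = eval annotatedLetter g at e
      rw [eval_annotatedLetter, eval_annotatedLetter] at e
      exact eval_eq_of_annotatedPaths_eq hF id f g (congrArg Prod.fst e)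

end ForestAlgebra

theorem mainTheorem5 (F : ForestAlgebra.{u}) :
    F.TwoDistributive ↔
      ∃ F₁ F₂ : ForestAlgebra.{u}, F₁.Distributive ∧ F₂.Distributive ∧
        F.Divides (ForestAlgebra.wreath F₁ F₂) :=
  ⟨fun hF => ⟨_, _, ForestAlgebra.ofSemilattice_distributive _,
      ForestAlgebra.ofSemilattice_distributive _, hF.divides_wreath⟩,
    fun ⟨_, _, h₁, h₂, h⟩ => ForestAlgebra.twoDistributive_of_divides h₁ h₂ h⟩
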